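/- For $g\in L^2(\mathbb R)$ (complex-valued), $a\in\mathbb R\setminus\{0\}$, $b>0$ and $k,m,n\in\mathbb Z$ write $E_{mb}T_{na}g(t)=e^{2\pi i mbt}g(t-na)$ and $$G_k(t)=\sum_{n\in\mathbb Z}g(t-na)\,\overline{g(t-na-k/b)} .$$ Say that $(g,a,b)$ satisfies the CC-condition if there is a constant $B<\infty$ with $\sum_{k\in\mathbb Z}|G_k(t)|\le B$ for almost every $t\in\mathbb R$. Suppose that $(g,a,b)$ satisfies the CC-condition. Then the WH-frame identity holds for every $f\in L^2(\mathbb R)$, with unconditional convergence; that is, the series defining each $G_k$ converges absolutely almost everywhere, each function $t\mapsto\overline{f(t)}f(t-k/b)G_k(t)$ is integrable, the sum on the left-hand side of $$\sum_{m,n\in\mathbb Z}|\langle f,E_{mb}T_{na}g\rangle|^2=\frac1b\sum_{k\in\mathbb Z}\int_{\mathbb R}\overline{f(t)}\,f(t-k/b)\,G_k(t)\,dt$$ is finite, the series over $k$ on the right-hand side converges unconditionally, and the two sides are equal. In particular, let $g$ belong to the Wiener amalgam space $W(L^\infty,L^1)$, i.e. let $g:\mathbb R\to\mathbb C$ be measurable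 with $\sum_{n\in\mathbb Z}\|g\cdot\chi_{[\alpha n,\alpha(n+1))}\|_\infty<\infty$ for some $\alpha>0$. Then $g\in L^2(\mathbb R)$, and for all $a\ne0$ and $b>0$ the triple $(g,a,b)$ satisfies the CC-condition, so that the WH-frame identity holds for every $f\in L^2(\mathbb R)$ with unconditional convergence. -/

import Mathlib

open MeasureTheory
open scoped ComplexConjugate ENNReal NNReal

noncomputable section

namespace WeylHeisenberg

/-- Translation: `(T_a f)(x) = f (x - a)`. -/
def translation (a : ℝ) (f : ℝ → ℂ) : ℝ → ℂ := fun x => f (x - a)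

/-- Modulation: `(E_a f)(x) = e^{2 π i a x} f x`. -/
def modulation (a : ℝ) (f : ℝ → ℂ) : ℝ → ℂ := fun x =>
  Complex.exp (2 * (Real.pi : ℂ) * Complex.I * (a : ℂ) * (x : ℂ)) * f x

/-- The Weyl-Heisenberg system `(g, a, b) = (E_{mb} T_{na} g)_{m, n}`. -/
def whSystem (g : ℝ → ℂ) (a b : ℝ) (m n : ℤ) : ℝ → ℂ :=
  modulation ((m : ℝ) * b) (translation ((n : ℝ) * a) g)

/-- The inner product `⟨f, h⟩ = ∫ f(t) conj (h(t)) dt` of `L²(ℝ)`, linear in the first variable. -/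
def l2Inner (f h : ℝ → ℂ) : ℂ := ∫ t, f t * conj (h t)

/-- The `n`-th term of the series defining `G_k(t)`. -/
def gTerm (g : ℝ → ℂ) (a b : ℝ) (k : ℤ) (t : ℝ) (n : ℤ) : ℂ :=
  g (t - (n : ℝ) * a) * conj (g (t - (n : ℝ) * a - (k : ℝ) / b))

/-- `G_k(t) = ∑ₙ g(t - na) conj (g(t - na - k/b))`. For `g ∈ L²(ℝ)` and `a ≠ 0` this series
converges absolutely for almost every `t`. -/
def gFun (g : ℝ → ℂ) (a b : ℝ) (k : ℤ) (t : ℝ) : ℂ := ∑' n : ℤ, gTerm g a b k t n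

/-- The CC-condition: for some finite `B`, `∑ₖ |G_k(t)| ≤ B` for almost every `t`. -/
def CCCondition (g : ℝ → ℂ) (a b : ℝ) : Prop :=
  ∃ B : ℝ≥0, ∀ᵐ t : ℝ, ∑' k : ℤ, ‖gFun g a b k t‖ₑ ≤ (B : ℝ≥0∞)

/-- The `k`-th integral on the right-hand side of the WH-frame identity has this integrand. -/
def whIntegrand (g : ℝ → ℂ) (a b : ℝ) (f : ℝ → ℂ) (k : ℤ) (t : ℝ) : ℂ :=
  conj (f t) * f (t - (k : ℝ) / b) * gFun g a b k t

/-- The WH-frame identity for `(g, a, b)` holds for `f`: all quantities in it are well defined,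
the left-hand series is finite, the right-hand series converges unconditionally
(`Summable` over `ℤ` is convergence along the net of all finite subsets), and they are equal. -/
structure WHFrameIdentity (g : ℝ → ℂ) (a b : ℝ) (f : ℝ → ℂ) : Prop where
  gTerm_summable : ∀ᵐ t : ℝ, ∀ k : ℤ, Summable (gTerm g a b k t)
  integrable : ∀ k : ℤ, Integrable (whIntegrand g a b f k) volume
  left_summable : Summable fun p : ℤ × ℤ => ‖l2Inner f (whSystem g a b p.1 p.2)‖ ^ 2
  right_summable : Summable fun k : ℤ => ∫ t, whIntegrand g a b f k t
  eq : ((∑' p : ℤ × ℤ, ‖l2Inner f (whSystem g a b p.1 p.2)‖ ^ 2 : ℝ) : ℂ)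
      = 1 / (b : ℂ) * ∑' k : ℤ, ∫ t, whIntegrand g a b f k t

/-- `‖g‖_{W, α} = ∑ₙ ‖g · χ_{[αn, α(n+1))}‖_∞`, with values in `[0, ∞]`. -/
def wienerNorm (α : ℝ) (g : ℝ → ℂ) : ℝ≥0∞ :=
  ∑' n : ℤ, eLpNorm (Set.indicator (Set.Ico (α * (n : ℝ)) (α * ((n : ℝ) + 1))) g) ∞ volume

/-- Membership in the Wiener amalgam space `W(L^∞, L^1)`. -/
def MemWiener (g : ℝ → ℂ) : Prop :=
  AEStronglyMeasurable g volume ∧ ∃ α : ℝ, 0 < α ∧ wienerNorm α g < ∞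

end WeylHeisenberg

end

/-! Fold the line onto one period `(0, 1/b]`. For fixed `t`, let `v k` be the sequence `n ↦ f(t -
k/b) conj (g(t - k/b - na))`, an element of `ℓ²(ℤ)` for almost every `t`. Its Gram matrix `⟨v k, v
l⟩` is the right-hand integrand of index `l - k` at `t - k/b`. The CC-condition bounds the rows of
the Hermitian kernel `G_{l-k}(t - k/b)`, so Schur's test makes the Gram matrix absolutely summable
with total at most `B ∑ₖ |f(t - k/b)|²`. Hence `∑ₖ v k` converges in `ℓ²`, and its squared norm is
the sum of the Gram entries (`hasSum_gram`, `fiber_identity`).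

The `n`-th coordinate of `∑ₖ v k` is the periodization `fiberSum`, whose Fourier integrals are the
`⟨f, E_{mb} T_{na} g⟩`. Parseval in `m` and integration over `t` give the identity, with no density
argument in `f`; the Schur bound integrates to `B ‖f‖²` and justifies every interchange.

For Wiener amalgam `g`, sums of `|g|` along any arithmetic progression are essentially bounded,
which gives the CC-condition. -/

namespace WeylHeisenberg

/-! ### Folding the line onto a period -/

section Periodization

theorem volume_eq_sum_map_sub_Ioc {c : ℝ} (hc : 0 < c) :
    (volume : Measure ℝ) = Measure.sum fun k : ℤ =>
      (volume.restrict (Set.Ioc 0 c)).map fun t => t - (k : ℝ) * c := by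
  have h1 : ∀ k : ℤ, (volume.restrict (Set.Ioc 0 c)).map (fun t => t - (k : ℝ) * c) =
      volume.restrict (Set.Ioc ((-k) • c) ((-k + 1) • c)) := by
    intro k
    have h := ((measurePreserving_sub_right volume ((k : ℝ) * c)).restrict_preimage_emb
      (MeasurableEquiv.subRight ((k : ℝ) * c)).measurableEmbedding
      (Set.Ioc ((-k) • c) ((-k + 1) • c))).map_eq
    rw [← h]
    congr 2
    ext t
    simp only [Set.mem_Ioc, Set.mem_preimage, zsmul_eq_mul]
    push_cast
    constructor <;> rintro ⟨h1, h2⟩ <;> constructor <;> linarith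
  simp_rw [h1]
  rw [← Measure.restrict_iUnion]
  · have : (⋃ k : ℤ, Set.Ioc ((-k) • c) ((-k + 1) • c)) = Set.univ := by
      rw [← iUnion_Ioc_zsmul hc]
      exact (Equiv.neg ℤ).surjective.iUnion_comp
        (fun k : ℤ => Set.Ioc (k • c) ((k + 1) • c))
    rw [this, Measure.restrict_univ]
  · exact (Set.pairwise_disjoint_Ioc_zsmul c).comp_of_injective neg_injective
  · exact fun _ => measurableSet_Ioc

theorem measurableEmbedding_sub (x : ℝ) : MeasurableEmbedding fun t : ℝ => t - x :=
  (MeasurableEquiv.subRight x).measurableEmbedding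

theorem lintegral_eq_tsum_Ioc {c : ℝ} (hc : 0 < c) (φ : ℝ → ℝ≥0∞) :
    ∫⁻ t, φ t = ∑' k : ℤ, ∫⁻ t in Set.Ioc 0 c, φ (t - (k : ℝ) * c) := by
  conv_lhs => rw [volume_eq_sum_map_sub_Ioc hc]
  rw [lintegral_sum_measure]
  exact tsum_congr fun k => (measurableEmbedding_sub _).lintegral_map _

theorem quasiMeasurePreserving_sub_restrict (x : ℝ) (s : Set ℝ) :
    Measure.QuasiMeasurePreserving (fun t : ℝ => t - x) (volume.restrict s) volume :=
  (measurePreserving_sub_right volume x).quasiMeasurePreserving.mono_left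
    Measure.restrict_le_self.absolutelyContinuous

theorem lintegral_eq_lintegral_Ioc_tsum {c : ℝ} (hc : 0 < c) {φ : ℝ → ℝ≥0∞} (hφ : AEMeasurable φ) :
    ∫⁻ t, φ t = ∫⁻ t in Set.Ioc 0 c, ∑' k : ℤ, φ (t - (k : ℝ) * c) := by
  rw [lintegral_eq_tsum_Ioc hc, lintegral_tsum]
  exact fun k => hφ.comp_quasiMeasurePreserving (quasiMeasurePreserving_sub_restrict _ _)

theorem hasSum_integral_Ioc {E : Type*} [NormedAddCommGroup E] [NormedSpace ℝ E]
    {c : ℝ} (hc : 0 < c) {φ : ℝ → E} (hφ : Integrable φ) :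
    HasSum (fun k : ℤ => ∫ t in Set.Ioc 0 c, φ (t - (k : ℝ) * c)) (∫ t, φ t) := by
  have h := hφ
  rw [volume_eq_sum_map_sub_Ioc hc] at h
  have h2 := hasSum_integral_measure h
  rw [← volume_eq_sum_map_sub_Ioc hc] at h2
  simpa only [(measurableEmbedding_sub _).integral_map] using h2

theorem integral_eq_integral_Ioc_tsum {E : Type*} [NormedAddCommGroup E] [NormedSpace ℝ E]
    {c : ℝ} (hc : 0 < c) {φ : ℝ → E} (hφ : Integrable φ) :
    ∫ t, φ t = ∫ t in Set.Ioc 0 c, ∑' k : ℤ, φ (t - (k : ℝ) * c) := by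
  rw [integral_tsum, (hasSum_integral_Ioc hc hφ).tsum_eq]
  · exact fun k => hφ.1.comp_quasiMeasurePreserving (quasiMeasurePreserving_sub_restrict _ _)
  · rw [← lintegral_eq_tsum_Ioc hc (fun t => ‖φ t‖ₑ)]
    exact hφ.2.ne

theorem ae_iff_ae_restrict_Ioc {c : ℝ} (hc : 0 < c) {P : ℝ → Prop} :
    (∀ᵐ t : ℝ, P t) ↔ ∀ᵐ t ∂volume.restrict (Set.Ioc 0 c), ∀ k : ℤ, P (t - (k : ℝ) * c) := by
  rw [volume_eq_sum_map_sub_Ioc hc, Measure.ae_sum_iff, ← volume_eq_sum_map_sub_Ioc hc, ae_all_iff]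
  simp only [(measurableEmbedding_sub _).ae_map_iff]

theorem ae_tsum_sub_lt_top {c : ℝ} (hc : 0 < c) {φ : ℝ → ℝ≥0∞} (hφ : AEMeasurable φ)
    (hfin : ∫⁻ t, φ t ≠ ∞) : ∀ᵐ t : ℝ, ∑' k : ℤ, φ (t - (k : ℝ) * c) < ∞ := by
  rw [ae_iff_ae_restrict_Ioc hc]
  rw [lintegral_eq_lintegral_Ioc_tsum hc hφ] at hfin
  have h := ae_lt_top' (AEMeasurable.tsum fun k =>
    hφ.comp_quasiMeasurePreserving (quasiMeasurePreserving_sub_restrict _ _)) hfin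
  filter_upwards [h] with t ht j
  -- The periodized sum is invariant under shifts by `j * c`, so finiteness on one period spreads to
  -- the line.
  rw [← (Equiv.addLeft j).tsum_eq] at ht
  refine (tsum_congr fun k => ?_).trans_lt ht
  show φ _ = φ _
  congr 1
  simp only [Equiv.coe_addLeft, Int.cast_add]
  ring

theorem ae_tsum_sub_lt_top_of_ne {a : ℝ} (ha : a ≠ 0) {φ : ℝ → ℝ≥0∞} (hφ : AEMeasurable φ)
    (hfin : ∫⁻ t, φ t ≠ ∞) : ∀ᵐ t : ℝ, ∑' n : ℤ, φ (t - (n : ℝ) * a) < ∞ := by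
  rcases ha.lt_or_gt with h | h
  · filter_upwards [ae_tsum_sub_lt_top (neg_pos.2 h) hφ hfin] with t ht
    rw [← (Equiv.neg ℤ).tsum_eq] at ht
    simpa using ht
  · exact ae_tsum_sub_lt_top h hφ hfin

theorem ae_forall_sub {P : ℝ → Prop} (h : ∀ᵐ t : ℝ, P t) (x : ℤ → ℝ) :
    ∀ᵐ t : ℝ, ∀ k : ℤ, P (t - x k) :=
  ae_all_iff.2 fun k => (measurePreserving_sub_right volume (x k)).quasiMeasurePreserving.ae h

end Periodization

/-! ### Families with summable Gram matrix -/

section Gram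

variable {ι κ : Type*}

/-- Cauchy criterion: `‖∑_{i ∈ t} v i‖²` is the sum of the Gram entries over `t ×ˢ t`, which misses
`S` as soon as `t` misses its first projection. -/
theorem summable_of_summable_inner {E : Type*} [NormedAddCommGroup E] [InnerProductSpace ℂ E]
    [CompleteSpace E] {v : κ → E} (h : Summable fun p : κ × κ => inner ℂ (v p.1) (v p.2)) :
    Summable v := by
  rw [summable_iff_vanishing_norm]
  intro ε hε
  obtain ⟨S, hS⟩ := summable_iff_vanishing_norm.1 h (ε ^ 2) (by positivity)
  classical
  refine ⟨S.image Prod.fst, fun t ht => ?_⟩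
  have hd : Disjoint (t ×ˢ t) S := by
    rw [Finset.disjoint_left] at ht ⊢
    intro p hp hpS
    exact ht (Finset.mem_product.1 hp).1 (Finset.mem_image_of_mem _ hpS)
  have h1 := hS _ hd
  rw [Finset.sum_product] at h1
  simp only [← inner_sum, ← sum_inner] at h1
  rw [inner_self_eq_norm_sq_to_K] at h1
  have h2 : ‖∑ i ∈ t, v i‖ ^ 2 < ε ^ 2 := by simpa using h1
  exact lt_of_pow_lt_pow_left₀ 2 hε.le h2

theorem hasSum_inner_norm_sq {E : Type*} [NormedAddCommGroup E] [InnerProductSpace ℂ E]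
    [CompleteSpace E] {v : κ → E} (h : Summable fun p : κ × κ => inner ℂ (v p.1) (v p.2)) :
    HasSum (fun p : κ × κ => inner ℂ (v p.1) (v p.2)) (((‖∑' k, v k‖ ^ 2 : ℝ)) : ℂ) := by
  have hv := summable_of_summable_inner h
  have h1 : ∑' p : κ × κ, inner ℂ (v p.1) (v p.2) = inner ℂ (∑' k, v k) (∑' k, v k) := by
    rw [h.tsum_prod]
    have h2 : ∀ k, ∑' l, inner ℂ (v k) (v l) = inner ℂ (v k) (∑' l, v l) := fun k =>
      ((innerSL ℂ (v k)).map_tsum hv).symm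
    simp_rw [h2]
    have h3 := ((innerSL ℂ (∑' l, v l)).hasSum hv.hasSum)
    have h4 := (Complex.hasSum_conj'.2 h3).tsum_eq
    simpa using h4
  have h5 := h.hasSum
  rw [h1, inner_self_eq_norm_sq_to_K] at h5
  simpa using h5

theorem memlp_two_iff {x : ι → ℂ} : Memℓp x 2 ↔ Summable fun n => ‖x n‖ ^ 2 := by
  rw [memℓp_gen_iff (by simp)]
  simp

theorem hasSum_norm_sq_lp (x : lp (fun _ : ι => ℂ) 2) :
    HasSum (fun n => ‖x n‖ ^ 2) (‖x‖ ^ 2) := by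
  have h := lp.hasSum_norm (p := 2) (by simp) x
  simpa using h

/-- The quadratic form of a family of square-summable columns `v k` with summable Gram matrix. -/
theorem hasSum_gram {v : κ → ι → ℂ} (hv : ∀ k, Summable fun n => ‖v k n‖ ^ 2)
    (h : Summable fun p : κ × κ => ∑' n, conj (v p.1 n) * v p.2 n) :
    Summable (fun n => ‖∑' k, v k n‖ ^ 2) ∧
      HasSum (fun p : κ × κ => ∑' n, conj (v p.1 n) * v p.2 n)
        ((∑' n, ‖∑' k, v k n‖ ^ 2 : ℝ) : ℂ) := by
  let w : κ → lp (fun _ : ι => ℂ) 2 := fun k => ⟨v k, memlp_two_iff.2 (hv k)⟩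
  have hw : ∀ k l, inner ℂ (w k) (w l) = ∑' n, conj (v k n) * v l n := by
    intro k l
    rw [lp.inner_eq_tsum]
    exact tsum_congr fun n => by simp [w, mul_comm]
  simp_rw [← hw] at h ⊢
  have hs := summable_of_summable_inner h
  -- Coordinate evaluation is continuous on `ℓ²`, so the norm sum is computed coordinatewise.
  have h1 : ∀ n, (∑' k, w k : lp (fun _ : ι => ℂ) 2) n = ∑' k, v k n := fun n =>
    (lp.evalCLM ℂ (fun _ : ι => ℂ) 2 n).map_tsum hs
  have h2 := hasSum_norm_sq_lp (∑' k, w k)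
  simp_rw [h1] at h2
  refine ⟨h2.summable, ?_⟩
  rw [h2.tsum_eq]
  exact hasSum_inner_norm_sq h

end Gram

theorem two_mul_le_add_sq_ennreal (x y : ℝ≥0∞) : 2 * (x * y) ≤ x ^ 2 + y ^ 2 := by
  rcases eq_or_ne x ∞ with rfl | hx
  · simp
  rcases eq_or_ne y ∞ with rfl | hy
  · simp
  lift x to ℝ≥0 using hx
  lift y to ℝ≥0 using hy
  norm_cast
  have := two_mul_le_add_sq x y
  rwa [mul_assoc] at this

/-- Schur's test for a symmetric nonnegative kernel. -/
theorem schur_test {κ : Type*} {M : κ → κ → ℝ≥0∞} {B : ℝ≥0∞} (hM : ∀ k l, M k l = M l k)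
    (hB : ∀ k, ∑' l, M k l ≤ B) (x : κ → ℝ≥0∞) :
    ∑' k, ∑' l, x k * x l * M k l ≤ B * ∑' k, x k ^ 2 := by
  have h1 : ∑' k, ∑' l, x k ^ 2 * M k l ≤ B * ∑' k, x k ^ 2 := by
    rw [← ENNReal.tsum_mul_left]
    refine ENNReal.tsum_le_tsum fun k => ?_
    rw [ENNReal.tsum_mul_left, mul_comm]
    gcongr
    exact hB k
  have h2 : ∑' k, ∑' l, x l ^ 2 * M k l ≤ B * ∑' k, x k ^ 2 := by
    rw [ENNReal.tsum_comm]
    simpa only [hM] using h1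
  -- Doubling avoids division in `2xy ≤ x² + y²`; the factor 2 is cancelled at the end.
  have h3 : 2 * ∑' k, ∑' l, x k * x l * M k l ≤ 2 * (B * ∑' k, x k ^ 2) := by
    calc 2 * ∑' k, ∑' l, x k * x l * M k l
        = ∑' k, ∑' l, 2 * (x k * x l) * M k l := by
          simp_rw [← ENNReal.tsum_mul_left, mul_assoc]
      _ ≤ ∑' k, ∑' l, (x k ^ 2 * M k l + x l ^ 2 * M k l) := by
          refine ENNReal.tsum_le_tsum fun k => ENNReal.tsum_le_tsum fun l => ?_
          rw [← add_mul]
          gcongr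
          exact two_mul_le_add_sq_ennreal _ _
      _ = ∑' k, ∑' l, x k ^ 2 * M k l + ∑' k, ∑' l, x l ^ 2 * M k l := by
          simp_rw [ENNReal.tsum_add]
      _ ≤ 2 * (B * ∑' k, x k ^ 2) := by
          rw [two_mul]
          exact add_le_add h1 h2
  exact (ENNReal.mul_le_mul_iff_right (by simp) (by simp)).1 h3

/-! ### Series of functions -/

section Series

theorem summable_of_tsum_enorm_ne_top {ι E : Type*} [NormedAddCommGroup E] [CompleteSpace E]
    {x : ι → E} (h : ∑' i, ‖x i‖ₑ ≠ ∞) : Summable x :=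
  (ENNReal.tsum_coe_ne_top_iff_summable.1 h : Summable fun i => ‖x i‖₊).of_nnnorm

theorem enorm_tsum_le {ι E : Type*} [NormedAddCommGroup E] (x : ι → E) :
    ‖∑' i, x i‖ₑ ≤ ∑' i, ‖x i‖ₑ := by
  by_cases h : ∑' i, ‖x i‖ₑ = ∞
  · simp [h]
  · have h1 : Summable fun i => ‖x i‖₊ := ENNReal.tsum_coe_ne_top_iff_summable.1 h
    have h2 := nnnorm_tsum_le h1
    simp only [enorm, ← ENNReal.coe_tsum h1]
    exact_mod_cast h2

variable {α : Type*} [MeasurableSpace α] {μ : Measure α} {ι E : Type*} [Countable ι]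
  [NormedAddCommGroup E] {f : ι → α → E}

theorem aestronglyMeasurable_tsum (hf : ∀ i, AEStronglyMeasurable (f i) μ)
    (h : ∀ᵐ x ∂μ, Summable fun i => f i x) :
    AEStronglyMeasurable (fun x => ∑' i, f i x) μ := by
  refine aestronglyMeasurable_of_tendsto_ae (Filter.atTop : Filter (Finset ι))
    (f := fun s x => ∑ i ∈ s, f i x)
    (fun s => Finset.aestronglyMeasurable_fun_sum s fun i _ => hf i) ?_
  filter_upwards [h] with x hx using hx.hasSum

theorem integral_tsum_of_lintegral_tsum [NormedSpace ℝ E] [CompleteSpace E]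
    (hf : ∀ i, AEStronglyMeasurable (f i) μ) (h : ∫⁻ x, ∑' i, ‖f i x‖ₑ ∂μ ≠ ∞) :
    (∀ i, Integrable (f i) μ) ∧ (Integrable (fun x => ∑' i, f i x) μ) ∧
      HasSum (fun i => ∫ x, f i x ∂μ) (∫ x, ∑' i, f i x ∂μ) := by
  have h1 : ∑' i, ∫⁻ x, ‖f i x‖ₑ ∂μ ≠ ∞ := by
    rwa [← lintegral_tsum fun i => (hf i).enorm]
  have hi : ∀ i, Integrable (f i) μ := fun i =>
    ⟨hf i, lt_top_iff_ne_top.2 (ENNReal.ne_top_of_tsum_ne_top h1 i)⟩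
  refine ⟨hi, ⟨aestronglyMeasurable_tsum hf ?_, ?_⟩, ?_⟩
  · filter_upwards [ae_lt_top' (AEMeasurable.tsum fun i => (hf i).enorm) h] with x hx
    exact summable_of_tsum_enorm_ne_top hx.ne
  · exact (lintegral_mono fun x => enorm_tsum_le _).trans_lt (lt_top_iff_ne_top.2 h)
  · rw [integral_tsum hf h1]
    refine (summable_of_tsum_enorm_ne_top (ne_top_of_le_ne_top h1 ?_)).hasSum
    exact ENNReal.tsum_le_tsum fun i => enorm_integral_le_lintegral_enorm _

theorem lintegral_enorm_sq_lt_top {f : α → E} (hf : MemLp f 2 μ) :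
    ∫⁻ x, ‖f x‖ₑ ^ 2 ∂μ < ∞ := by
  have h := (eLpNorm_lt_top_iff_lintegral_rpow_enorm_lt_top (by simp) (by simp)).1 hf.2
  simpa using h

end Series

/-! ### Parseval on a period -/

section Parseval

theorem hasSum_sq_fourier_Ioc {b : ℝ} (hb : 0 < b) {F : ℝ → ℂ}
    (hF : MemLp F 2 (volume.restrict (Set.Ioc 0 b⁻¹))) :
    HasSum (fun m : ℤ => ‖∫ t in Set.Ioc 0 b⁻¹,
        F t * Complex.exp (-(2 * (Real.pi : ℂ) * Complex.I * ((m : ℝ) * b : ℝ) * (t : ℂ)))‖ ^ 2)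
      (b⁻¹ * ∫ t in Set.Ioc 0 b⁻¹, ‖F t‖ ^ 2) := by
  have hc : 0 < b⁻¹ := inv_pos.2 hb
  -- The factor `(b⁻¹)²` undoes the division by the period length in the Fourier coefficients.
  have h := (hasSum_sq_fourierCoeffOn hc hF).mul_left ((b⁻¹) ^ 2)
  convert! h using 1
  · ext m
    rw [fourierCoeffOn_eq_integral, intervalIntegral.integral_of_le hc.le, norm_smul, mul_pow]
    rw [← mul_assoc]
    have h1 : b⁻¹ ^ 2 * ‖1 / (b⁻¹ - 0)‖ ^ 2 = 1 := by
      rw [Real.norm_eq_abs, sq_abs]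
      field_simp
      simp
    rw [h1, one_mul]
    congr 2
    refine integral_congr_ae (Filter.Eventually.of_forall fun t => ?_)
    simp only [fourier_coe_apply, smul_eq_mul]
    rw [mul_comm]
    congr 2
    push_cast
    have : (b : ℂ) ≠ 0 := by exact_mod_cast hb.ne'
    field_simp
    simp
  · rw [intervalIntegral.integral_of_le hc.le, smul_eq_mul, sub_zero, inv_inv, ← mul_assoc]
    congr 1
    field_simp

end Parseval

/-! ### The identity on a single fiber -/

section Fiber

/-- The `b⁻¹`-periodization of `f · conj (T_{na} g)`. -/
noncomputable def fiberSum (f g : ℝ → ℂ) (a b : ℝ) (n : ℤ) (t : ℝ) : ℂ :=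
  ∑' k : ℤ, f (t - (k : ℝ) * b⁻¹) * conj (g (t - (k : ℝ) * b⁻¹ - (n : ℝ) * a))

variable {f g : ℝ → ℂ} {a b : ℝ}

theorem tsum_conj_mul_eq_whIntegrand (k l : ℤ) (t : ℝ) :
    ∑' n : ℤ, conj (f (t - (k : ℝ) * b⁻¹) * conj (g (t - (k : ℝ) * b⁻¹ - (n : ℝ) * a))) *
        (f (t - (l : ℝ) * b⁻¹) * conj (g (t - (l : ℝ) * b⁻¹ - (n : ℝ) * a))) =
      whIntegrand g a b f (l - k) (t - (k : ℝ) * b⁻¹) := by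
  rw [whIntegrand, gFun, ← tsum_mul_left]
  refine tsum_congr fun n => ?_
  have h1 : t - (k : ℝ) * b⁻¹ - ((l - k : ℤ) : ℝ) / b = t - (l : ℝ) * b⁻¹ := by
    push_cast; ring
  have h2 : t - (k : ℝ) * b⁻¹ - (n : ℝ) * a - ((l - k : ℤ) : ℝ) / b =
      t - (l : ℝ) * b⁻¹ - (n : ℝ) * a := by
    push_cast; ring
  rw [gTerm, h1, h2]
  simp only [map_mul, Complex.conj_conj]
  ring

/-- Hermitian symmetry of the Gram kernel, which supplies the symmetry needed in `schur_test`. -/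
theorem gFun_sub_eq_conj (k l : ℤ) (t : ℝ) :
    gFun g a b (l - k) (t - (k : ℝ) * b⁻¹) = conj (gFun g a b (k - l) (t - (l : ℝ) * b⁻¹)) := by
  rw [gFun, gFun, Complex.conj_tsum]
  refine tsum_congr fun n => ?_
  have h1 : t - (k : ℝ) * b⁻¹ - (n : ℝ) * a - ((l - k : ℤ) : ℝ) / b =
      t - (l : ℝ) * b⁻¹ - (n : ℝ) * a := by
    push_cast; ring
  have h2 : t - (l : ℝ) * b⁻¹ - (n : ℝ) * a - ((k - l : ℤ) : ℝ) / b =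
      t - (k : ℝ) * b⁻¹ - (n : ℝ) * a := by
    push_cast; ring
  rw [gTerm, gTerm, h1, h2]
  simp only [map_mul, Complex.conj_conj]
  ring

theorem tsum_enorm_whIntegrand_le {B : ℝ≥0∞} {t : ℝ}
    (hB : ∀ k : ℤ, ∑' j : ℤ, ‖gFun g a b j (t - (k : ℝ) * b⁻¹)‖ₑ ≤ B) :
    ∑' k : ℤ, ∑' l : ℤ, ‖whIntegrand g a b f (l - k) (t - (k : ℝ) * b⁻¹)‖ₑ ≤
      B * ∑' k : ℤ, ‖f (t - (k : ℝ) * b⁻¹)‖ₑ ^ 2 := by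
  have h1 : ∀ k l : ℤ, ‖whIntegrand g a b f (l - k) (t - (k : ℝ) * b⁻¹)‖ₑ =
      ‖f (t - (k : ℝ) * b⁻¹)‖ₑ * ‖f (t - (l : ℝ) * b⁻¹)‖ₑ *
        ‖gFun g a b (l - k) (t - (k : ℝ) * b⁻¹)‖ₑ := by
    intro k l
    have h : t - (k : ℝ) * b⁻¹ - ((l - k : ℤ) : ℝ) / b = t - (l : ℝ) * b⁻¹ := by
      push_cast; ring
    rw [whIntegrand, h, enorm_mul, enorm_mul, RCLike.enorm_conj]
  simp_rw [h1]
  refine schur_test (fun k l => ?_) (fun k => ?_) (fun k : ℤ => ‖f (t - (k : ℝ) * b⁻¹)‖ₑ)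
  · rw [gFun_sub_eq_conj, RCLike.enorm_conj]
  · rw [← (Equiv.addRight k).tsum_eq]
    simpa using hB k

/-- The two bounds dominate the two series so that both can be integrated termwise; the equality is
the frame identity before integration. -/
theorem fiber_identity {B : ℝ≥0} {t : ℝ}
    (hg : ∀ k : ℤ, Summable fun n : ℤ => ‖g (t - (k : ℝ) * b⁻¹ - (n : ℝ) * a)‖ ^ 2)
    (hB : ∀ k : ℤ, ∑' j : ℤ, ‖gFun g a b j (t - (k : ℝ) * b⁻¹)‖ₑ ≤ B)
    (hf : ∑' k : ℤ, ‖f (t - (k : ℝ) * b⁻¹)‖ₑ ^ 2 < ∞) :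
    (∑' k : ℤ, ∑' j : ℤ, ‖whIntegrand g a b f j (t - (k : ℝ) * b⁻¹)‖ₑ ≤
      B * ∑' k : ℤ, ‖f (t - (k : ℝ) * b⁻¹)‖ₑ ^ 2) ∧
    (∑' n : ℤ, ‖‖fiberSum f g a b n t‖ ^ 2‖ₑ ≤ B * ∑' k : ℤ, ‖f (t - (k : ℝ) * b⁻¹)‖ₑ ^ 2) ∧
    (∑' k : ℤ, ∑' j : ℤ, whIntegrand g a b f j (t - (k : ℝ) * b⁻¹) =
      ((∑' n : ℤ, ‖fiberSum f g a b n t‖ ^ 2 : ℝ) : ℂ)) := by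
  have hle := tsum_enorm_whIntegrand_le (f := f) hB
  have hfin : ∑' p : ℤ × ℤ, ‖whIntegrand g a b f (p.2 - p.1) (t - (p.1 : ℝ) * b⁻¹)‖ₑ ≠ ∞ := by
    rw [ENNReal.tsum_prod' (f := fun p : ℤ × ℤ =>
      ‖whIntegrand g a b f (p.2 - p.1) (t - (p.1 : ℝ) * b⁻¹)‖ₑ)]
    exact ne_top_of_le_ne_top (ENNReal.mul_ne_top ENNReal.coe_ne_top hf.ne) hle
  have hs := summable_of_tsum_enorm_ne_top hfin
  obtain ⟨(h1 : Summable fun n => ‖fiberSum f g a b n t‖ ^ 2), h2⟩ := hasSum_gram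
    (v := fun (k n : ℤ) => f (t - (k : ℝ) * b⁻¹) * conj (g (t - (k : ℝ) * b⁻¹ - (n : ℝ) * a)))
    (fun k => by simpa [mul_pow] using (hg k).mul_left _)
    (by simpa only [tsum_conj_mul_eq_whIntegrand] using hs)
  simp only [tsum_conj_mul_eq_whIntegrand] at h2
  have hshift : ∀ k : ℤ, ∑' l : ℤ, whIntegrand g a b f (l - k) (t - (k : ℝ) * b⁻¹) =
      ∑' j : ℤ, whIntegrand g a b f j (t - (k : ℝ) * b⁻¹) := fun k =>
    (Equiv.subRight k).tsum_eq fun j => whIntegrand g a b f j (t - (k : ℝ) * b⁻¹)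
  have hshift' : ∀ k : ℤ, ∑' l : ℤ, ‖whIntegrand g a b f (l - k) (t - (k : ℝ) * b⁻¹)‖ₑ =
      ∑' j : ℤ, ‖whIntegrand g a b f j (t - (k : ℝ) * b⁻¹)‖ₑ := fun k =>
    (Equiv.subRight k).tsum_eq fun j => ‖whIntegrand g a b f j (t - (k : ℝ) * b⁻¹)‖ₑ
  simp_rw [hshift'] at hle
  have heq : ∑' k : ℤ, ∑' j : ℤ, whIntegrand g a b f j (t - (k : ℝ) * b⁻¹) =
      ((∑' n : ℤ, ‖fiberSum f g a b n t‖ ^ 2 : ℝ) : ℂ) := by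
    simp_rw [← hshift]
    rw [← hs.tsum_prod]
    exact h2.tsum_eq
  refine ⟨hle, ?_, heq⟩
  have h3 : ∑' n : ℤ, ‖‖fiberSum f g a b n t‖ ^ 2‖ₑ =
      ‖∑' k : ℤ, ∑' j : ℤ, whIntegrand g a b f j (t - (k : ℝ) * b⁻¹)‖ₑ := by
    rw [heq, ← ofReal_norm, Complex.norm_real, ofReal_norm,
      Real.enorm_eq_ofReal (tsum_nonneg fun n => by positivity),
      ENNReal.ofReal_tsum_of_nonneg (fun n => by positivity) h1]
    exact tsum_congr fun n => Real.enorm_eq_ofReal (by positivity)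
  rw [h3]
  exact (enorm_tsum_le _).trans ((ENNReal.tsum_le_tsum fun k => enorm_tsum_le _).trans hle)

end Fiber

/-! ### Integrating over the fibers -/

section Identity

variable {f g : ℝ → ℂ} {a b : ℝ}

theorem aestronglyMeasurable_comp_sub {E : Type*} [TopologicalSpace E] {f : ℝ → E}
    (hf : AEStronglyMeasurable f volume) (x : ℝ) :
    AEStronglyMeasurable (fun t => f (t - x)) volume :=
  hf.comp_quasiMeasurePreserving (measurePreserving_sub_right volume x).quasiMeasurePreserving

theorem memLp_comp_sub {f : ℝ → ℂ} {p : ℝ≥0∞} (hf : MemLp f p volume) (x : ℝ) :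
    MemLp (fun t => f (t - x)) p volume :=
  hf.comp_measurePreserving (measurePreserving_sub_right volume x)

theorem ae_summable_sq (ha : a ≠ 0) (hg : MemLp g 2 volume) :
    ∀ᵐ t : ℝ, Summable fun n : ℤ => ‖g (t - (n : ℝ) * a)‖ ^ 2 := by
  filter_upwards [ae_tsum_sub_lt_top_of_ne ha (hg.1.enorm.pow_const 2)
    (lintegral_enorm_sq_lt_top hg).ne] with t ht
  refine summable_of_tsum_enorm_ne_top ?_
  simpa only [enorm_pow, enorm_norm] using ht.ne

theorem ae_summable_gTerm (ha : a ≠ 0) (hg : MemLp g 2 volume) :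
    ∀ᵐ t : ℝ, ∀ k : ℤ, Summable (gTerm g a b k t) := by
  filter_upwards [ae_summable_sq ha hg,
    ae_forall_sub (ae_summable_sq ha hg) fun k : ℤ => (k : ℝ) / b] with t ht hk k
  refine Summable.of_norm_bounded (ht.add (hk k)) fun n => ?_
  have h : t - (n : ℝ) * a - (k : ℝ) / b = t - (k : ℝ) / b - (n : ℝ) * a := by ring
  rw [gTerm, norm_mul, RCLike.norm_conj, h]
  nlinarith [two_mul_le_add_sq ‖g (t - (n : ℝ) * a)‖ ‖g (t - (k : ℝ) / b - (n : ℝ) * a)‖,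
    norm_nonneg (g (t - (n : ℝ) * a)), norm_nonneg (g (t - (k : ℝ) / b - (n : ℝ) * a)),
    mul_nonneg (norm_nonneg (g (t - (n : ℝ) * a))) (norm_nonneg (g (t - (k : ℝ) / b - (n : ℝ) * a)))]

theorem aestronglyMeasurable_gFun (ha : a ≠ 0) (hg : MemLp g 2 volume) (k : ℤ) :
    AEStronglyMeasurable (gFun g a b k) volume := by
  refine aestronglyMeasurable_tsum (f := fun n t => gTerm g a b k t n) (fun n => ?_) ?_
  · refine (aestronglyMeasurable_comp_sub hg.1 _).mul ?_
    have h := aestronglyMeasurable_comp_sub hg.1 ((n : ℝ) * a + (k : ℝ) / b)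
    simp only [← sub_sub] at h
    exact Complex.continuous_conj.comp_aestronglyMeasurable h
  · filter_upwards [ae_summable_gTerm ha hg] with t ht using ht k

theorem aestronglyMeasurable_whIntegrand (ha : a ≠ 0) (hg : MemLp g 2 volume)
    (hf : MemLp f 2 volume) (k : ℤ) : AEStronglyMeasurable (whIntegrand g a b f k) volume :=
  ((Complex.continuous_conj.comp_aestronglyMeasurable hf.1).mul
    (aestronglyMeasurable_comp_sub hf.1 _)).mul (aestronglyMeasurable_gFun ha hg k)

theorem integrable_mul_conj_sub (hf : MemLp f 2 volume) (hg : MemLp g 2 volume) (x : ℝ) :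
    Integrable fun t => f t * conj (g (t - x)) :=
  hf.integrable_mul (memLp_comp_sub hg x).star

theorem aestronglyMeasurable_fiberSum (hb : 0 < b) (hf : MemLp f 2 volume)
    (hg : MemLp g 2 volume) (n : ℤ) :
    AEStronglyMeasurable (fiberSum f g a b n) (volume.restrict (Set.Ioc 0 b⁻¹)) := by
  have hi := integrable_mul_conj_sub hf hg ((n : ℝ) * a)
  refine AEStronglyMeasurable.restrict (aestronglyMeasurable_tsum (fun k : ℤ =>
    aestronglyMeasurable_comp_sub hi.1 ((k : ℝ) * b⁻¹)) ?_)
  filter_upwards [ae_tsum_sub_lt_top (inv_pos.2 hb) hi.1.enorm hi.2.ne] with t ht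
  exact summable_of_tsum_enorm_ne_top ht.ne

theorem l2Inner_whSystem_eq (hb : 0 < b) (hf : MemLp f 2 volume) (hg : MemLp g 2 volume)
    (m n : ℤ) : l2Inner f (whSystem g a b m n) = ∫ t in Set.Ioc 0 b⁻¹, fiberSum f g a b n t *
      Complex.exp (-(2 * (Real.pi : ℂ) * Complex.I * ((m : ℝ) * b : ℝ) * (t : ℂ))) := by
  set e : ℝ → ℂ := fun t =>
    Complex.exp (-(2 * (Real.pi : ℂ) * Complex.I * ((m : ℝ) * b : ℝ) * (t : ℂ))) with he
  have hnorm : ∀ t, ‖e t‖ = 1 := by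
    intro t
    have h : -(2 * (Real.pi : ℂ) * Complex.I * ((m : ℝ) * b : ℝ) * (t : ℂ)) =
        ((-(2 * Real.pi * (m * b) * t) : ℝ) : ℂ) * Complex.I := by push_cast; ring
    simp only [he, h, Complex.norm_exp_ofReal_mul_I]
  -- The exponential has period `1/b`, so folding leaves it outside the sum over `k`.
  have hper : ∀ (t : ℝ) (k : ℤ), e (t - (k : ℝ) * b⁻¹) = e t := by
    intro t k
    have hb' : (b : ℂ) ≠ 0 := by exact_mod_cast hb.ne'
    have h : -(2 * (Real.pi : ℂ) * Complex.I * ((m : ℝ) * b : ℝ) * ((t - (k : ℝ) * b⁻¹ : ℝ) : ℂ)) =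
        -(2 * (Real.pi : ℂ) * Complex.I * ((m : ℝ) * b : ℝ) * (t : ℂ)) +
          ((m * k : ℤ) : ℂ) * (2 * Real.pi * Complex.I) := by
      push_cast; field_simp; ring
    simp only [he, h, Complex.exp_add, Complex.exp_int_mul_two_pi_mul_I, mul_one]
  have hint : Integrable fun t => f t * conj (g (t - (n : ℝ) * a)) * e t := by
    refine (integrable_mul_conj_sub hf hg ((n : ℝ) * a)).mul_bdd (c := 1) ?_
      (Filter.Eventually.of_forall fun t => (hnorm t).le)
    exact Continuous.aestronglyMeasurable (by fun_prop)
  have h1 : l2Inner f (whSystem g a b m n) =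
      ∫ t, f t * conj (g (t - (n : ℝ) * a)) * e t := by
    refine integral_congr_ae (Filter.Eventually.of_forall fun t => ?_)
    have h2 : conj (Complex.exp (2 * (Real.pi : ℂ) * Complex.I * ((m : ℝ) * b : ℝ) * (t : ℂ))) =
        e t := by
      rw [← Complex.exp_conj]
      simp [he, Complex.conj_ofNat]
    simp only [whSystem, modulation, translation, map_mul, h2]
    ring
  rw [h1, integral_eq_integral_Ioc_tsum (inv_pos.2 hb) hint]
  refine integral_congr_ae (Filter.Eventually.of_forall fun t => ?_)
  simp only [hper t]
  simp only [tsum_mul_right, fiberSum, he]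

theorem whFrameIdentity_of_ccCondition (ha : a ≠ 0) (hb : 0 < b) (hg : MemLp g 2 volume)
    (hcc : CCCondition g a b) (hf : MemLp f 2 volume) : WHFrameIdentity g a b f := by
  obtain ⟨B, hB⟩ := hcc
  have hc : 0 < b⁻¹ := inv_pos.2 hb
  have hf2 := lintegral_enorm_sq_lt_top hf
  have hfm : AEMeasurable (fun t => ‖f t‖ₑ ^ 2) volume := hf.1.enorm.pow_const 2
  have hfib : ∀ᵐ t ∂volume.restrict (Set.Ioc 0 b⁻¹), _ := ae_restrict_of_ae (by
    filter_upwards [ae_forall_sub (ae_summable_sq ha hg) fun k : ℤ => (k : ℝ) * b⁻¹,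
      ae_forall_sub hB fun k : ℤ => (k : ℝ) * b⁻¹, ae_tsum_sub_lt_top hc hfm hf2.ne]
      with t h1 h2 h3 using fiber_identity (f := f) h1 h2 h3)
  have hBf : ∫⁻ t in Set.Ioc 0 b⁻¹, B * ∑' k : ℤ, ‖f (t - (k : ℝ) * b⁻¹)‖ₑ ^ 2 ≠ ∞ := by
    rw [lintegral_const_mul' _ _ ENNReal.coe_ne_top,
      ← lintegral_eq_lintegral_Ioc_tsum hc hfm]
    exact ENNReal.mul_ne_top ENNReal.coe_ne_top hf2.ne
  have hWm := fun k => aestronglyMeasurable_whIntegrand (b := b) ha hg hf k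
  have hFm := fun n => aestronglyMeasurable_fiberSum (a := a) hb hf hg n
  obtain ⟨hWi, hWsi, hWs⟩ := integral_tsum_of_lintegral_tsum hWm (by
    rw [lintegral_eq_lintegral_Ioc_tsum hc (AEMeasurable.tsum fun k => (hWm k).enorm)]
    exact ne_top_of_le_ne_top hBf (lintegral_mono_ae (hfib.mono fun t ht => ht.1)))
  obtain ⟨hFi, -, hFs⟩ := integral_tsum_of_lintegral_tsum
    (f := fun n t => ‖fiberSum f g a b n t‖ ^ 2) (fun n => (hFm n).norm.pow 2)
    (ne_top_of_le_ne_top hBf (lintegral_mono_ae (hfib.mono fun t ht => ht.2.1)))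
  have hW : ∫ t, ∑' k : ℤ, whIntegrand g a b f k t =
      ((∫ t in Set.Ioc 0 b⁻¹, ∑' n : ℤ, ‖fiberSum f g a b n t‖ ^ 2 : ℝ) : ℂ) := by
    rw [integral_eq_integral_Ioc_tsum hc hWsi, ← integral_complex_ofReal]
    exact integral_congr_ae (hfib.mono fun t ht => ht.2.2)
  have hP : ∀ n : ℤ, HasSum (fun m : ℤ => ‖l2Inner f (whSystem g a b m n)‖ ^ 2)
      (b⁻¹ * ∫ t in Set.Ioc 0 b⁻¹, ‖fiberSum f g a b n t‖ ^ 2) := by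
    intro n
    simp only [l2Inner_whSystem_eq hb hf hg]
    exact hasSum_sq_fourier_Ioc hb ((memLp_two_iff_integrable_sq_norm (hFm n)).2 (hFi n))
  have hsum := hFs.mul_left b⁻¹
  -- The pair is swapped because Parseval sums over `m` first, for fixed `n`.
  have hL : Summable fun p : ℤ × ℤ => ‖l2Inner f (whSystem g a b p.2 p.1)‖ ^ 2 := by
    refine (summable_prod_of_nonneg fun p => by positivity).2 ⟨fun n => (hP n).summable, ?_⟩
    simpa only [(hP _).tsum_eq] using hsum.summable
  refine ⟨ae_summable_gTerm ha hg, hWi, hL.prod_symm, hWs.summable, ?_⟩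
  have h1 : ∑' p : ℤ × ℤ, ‖l2Inner f (whSystem g a b p.1 p.2)‖ ^ 2 =
      b⁻¹ * ∫ t in Set.Ioc 0 b⁻¹, ∑' n : ℤ, ‖fiberSum f g a b n t‖ ^ 2 := by
    rw [← (Equiv.prodComm ℤ ℤ).tsum_eq]
    refine hL.tsum_prod.trans ?_
    simpa only [(hP _).tsum_eq] using hsum.tsum_eq
  rw [h1, hWs.tsum_eq, hW]
  push_cast
  rw [one_div]

end Identity

/-! ### The Wiener amalgam space -/

section Wiener

variable {g : ℝ → ℂ} {α : ℝ}

/-- The essential supremum of `|g|` on `[αn, α(n+1))`. -/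
noncomputable def localSup (α : ℝ) (g : ℝ → ℂ) (n : ℤ) : ℝ≥0∞ :=
  eLpNorm (Set.indicator (Set.Ico (α * (n : ℝ)) (α * ((n : ℝ) + 1))) g) ∞ volume

theorem ae_enorm_le_localSup (hα : 0 < α) (g : ℝ → ℂ) :
    ∀ᵐ t : ℝ, ‖g t‖ₑ ≤ localSup α g ⌊t / α⌋ := by
  have h : ∀ᵐ t : ℝ, ∀ n : ℤ,
      ‖Set.indicator (Set.Ico (α * (n : ℝ)) (α * ((n : ℝ) + 1))) g t‖ₑ ≤ localSup α g n := by
    rw [ae_all_iff]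
    intro n
    rw [localSup, eLpNorm_exponent_top]
    exact enorm_ae_le_eLpNormEssSup _ _
  filter_upwards [h] with t ht
  have h1 := ht ⌊t / α⌋
  rwa [Set.indicator_of_mem] at h1
  constructor
  · rw [mul_comm, ← le_div_iff₀ hα]
    exact Int.floor_le _
  · rw [mul_comm, ← div_lt_iff₀ hα]
    exact Int.lt_floor_add_one _

/-- An arithmetic progression of step `d` meets each cell `[αn, α(n+1))` at most `N` times
when `α ≤ N |d|`. -/
theorem tsum_floor_sub_le (hα : 0 < α) {d : ℝ} {N : ℕ} [NeZero N] (hN : α ≤ N * |d|)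
    (w : ℤ → ℝ≥0∞) (t : ℝ) :
    ∑' k : ℤ, w ⌊(t - (k : ℝ) * d) / α⌋ ≤ N * ∑' n : ℤ, w n := by
  -- Split `k` by residue mod `N`: within a class, points are at least `N|d| ≥ α` apart, so they lie
  -- in distinct cells.
  rw [← (Int.divModEquiv N).symm.tsum_eq, ENNReal.tsum_prod', ENNReal.tsum_comm, tsum_fintype]
  have h : ∀ r : Fin N, ∑' q : ℤ,
      w ⌊(t - (((Int.divModEquiv N).symm (q, r) : ℤ) : ℝ) * d) / α⌋ ≤ ∑' n : ℤ, w n := by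
    intro r
    refine ENNReal.tsum_comp_le_tsum_of_injective
      (f := fun q : ℤ => ⌊(t - (((Int.divModEquiv N).symm (q, r) : ℤ) : ℝ) * d) / α⌋) ?_ w
    intro p q hpq
    by_contra hne
    have h1 := Int.abs_sub_lt_one_of_floor_eq_floor hpq
    simp only [Int.divModEquiv_symm_apply] at h1
    rw [← sub_div, abs_div, abs_of_pos hα, div_lt_one hα] at h1
    push_cast at h1
    have h2 : t - ((p : ℝ) * N + (r : ℕ)) * d - (t - ((q : ℝ) * N + (r : ℕ)) * d) =
        ((q - p : ℤ) : ℝ) * (N * d) := by push_cast; ring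
    have h3 : (1 : ℝ) ≤ |((q - p : ℤ) : ℝ)| := by
      rw [← Int.cast_abs]
      exact_mod_cast Int.one_le_abs (sub_ne_zero.2 (Ne.symm hne))
    have h4 : (N : ℝ) * |d| ≤ |((q - p : ℤ) : ℝ) * (N * d)| := by
      rw [abs_mul, abs_mul, Nat.abs_cast]
      exact le_mul_of_one_le_left (by positivity) h3
    rw [← h2] at h4
    linarith
  calc _ ≤ ∑ _r : Fin N, ∑' n : ℤ, w n := Finset.sum_le_sum fun r _ => h r
    _ = N * ∑' n : ℤ, w n := by simp

theorem exists_nat_le_mul_abs (α : ℝ) {d : ℝ} (hd : d ≠ 0) : ∃ N : ℕ, N ≠ 0 ∧ α ≤ N * |d| := by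
  obtain ⟨N, hN⟩ := exists_nat_ge (α / |d|)
  have hd' : 0 < |d| := abs_pos.2 hd
  refine ⟨N + 1, by simp, ?_⟩
  rw [div_le_iff₀ hd'] at hN
  push_cast
  nlinarith

theorem ae_tsum_enorm_sub_le (hα : 0 < α) (g : ℝ → ℂ) {d : ℝ} {N : ℕ} [NeZero N]
    (hN : α ≤ N * |d|) :
    ∀ᵐ t : ℝ, ∑' k : ℤ, ‖g (t - (k : ℝ) * d)‖ₑ ≤ N * wienerNorm α g := by
  filter_upwards [ae_forall_sub (ae_enorm_le_localSup hα g) fun k : ℤ => (k : ℝ) * d] with t ht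
  exact (ENNReal.tsum_le_tsum ht).trans (tsum_floor_sub_le hα hN (localSup α g) t)

/-- Almost everywhere `|g| ≤ ‖g‖_W`, so `∫ |g|² ≤ ‖g‖_W ∫ |g| ≤ α ‖g‖_W²`. -/
theorem MemWiener.memLp_two (hg : MemWiener g) : MemLp g 2 volume := by
  obtain ⟨hm, α, hα, hW⟩ := hg
  refine ⟨hm, ?_⟩
  have h1 : ∫⁻ t, ‖g t‖ₑ ≤ wienerNorm α g * volume (Set.Ioc 0 α) := by
    rw [lintegral_eq_lintegral_Ioc_tsum hα hm.enorm, ← setLIntegral_const]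
    refine lintegral_mono_ae (ae_restrict_of_ae ?_)
    have h := ae_tsum_enorm_sub_le hα g (d := α) (N := 1) (by simp [le_abs_self])
    simpa using h
  have h2 : ∫⁻ t, ‖g t‖ₑ ^ 2 ≤ wienerNorm α g * ∫⁻ t, ‖g t‖ₑ := by
    rw [← lintegral_const_mul' _ _ hW.ne]
    refine lintegral_mono_ae ?_
    filter_upwards [ae_enorm_le_localSup hα g] with t ht
    rw [sq]
    gcongr
    exact ht.trans (ENNReal.le_tsum (f := localSup α g) _)
  rw [eLpNorm_lt_top_iff_lintegral_rpow_enorm_lt_top (by simp) (by simp)]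
  have h3 : wienerNorm α g * (wienerNorm α g * volume (Set.Ioc 0 α)) < ∞ :=
    ENNReal.mul_lt_top hW (ENNReal.mul_lt_top hW (by simp))
  have h4 := (h2.trans (by gcongr)).trans_lt h3
  simpa using h4

/-- After exchanging sums, the inner sum runs over steps `1/b` and the outer over steps `a`; each is
bounded by a multiple of `‖g‖_W`. -/
theorem MemWiener.ccCondition (hg : MemWiener g) {a b : ℝ} (ha : a ≠ 0) (hb : 0 < b) :
    CCCondition g a b := by
  obtain ⟨-, α, hα, hW⟩ := hg
  obtain ⟨N, hN0, hN⟩ := exists_nat_le_mul_abs α ha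
  obtain ⟨M, hM0, hM⟩ := exists_nat_le_mul_abs α (inv_pos.2 hb).ne'
  have := NeZero.mk hN0
  have := NeZero.mk hM0
  have hfin : N * wienerNorm α g * (M * wienerNorm α g) ≠ ∞ :=
    ENNReal.mul_ne_top (ENNReal.mul_ne_top (by simp) hW.ne) (ENNReal.mul_ne_top (by simp) hW.ne)
  refine ⟨(N * wienerNorm α g * (M * wienerNorm α g)).toNNReal, ?_⟩
  filter_upwards [ae_tsum_enorm_sub_le hα g hN,
    ae_forall_sub (ae_tsum_enorm_sub_le hα g hM) fun n : ℤ => (n : ℝ) * a] with t h1 h2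
  rw [ENNReal.coe_toNNReal hfin]
  calc ∑' k : ℤ, ‖gFun g a b k t‖ₑ
      ≤ ∑' k : ℤ, ∑' n : ℤ, ‖gTerm g a b k t n‖ₑ :=
        ENNReal.tsum_le_tsum fun k => enorm_tsum_le _
    _ = ∑' n : ℤ, ‖g (t - (n : ℝ) * a)‖ₑ *
          ∑' k : ℤ, ‖g (t - (n : ℝ) * a - (k : ℝ) * b⁻¹)‖ₑ := by
        rw [ENNReal.tsum_comm]
        simp_rw [← ENNReal.tsum_mul_left, gTerm, enorm_mul, RCLike.enorm_conj, div_eq_mul_inv]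
    _ ≤ ∑' n : ℤ, ‖g (t - (n : ℝ) * a)‖ₑ * (M * wienerNorm α g) :=
        ENNReal.tsum_le_tsum fun n => mul_le_mul_right (h2 n) _
    _ ≤ N * wienerNorm α g * (M * wienerNorm α g) := by
        rw [ENNReal.tsum_mul_right]
        gcongr

end Wiener

end WeylHeisenberg

theorem mainTheorem6 :
    (∀ (g : ℝ → ℂ) (a b : ℝ), a ≠ 0 → 0 < b → MemLp g 2 volume →
      WeylHeisenberg.CCCondition g a b →
      ∀ f : ℝ → ℂ, MemLp f 2 volume → WeylHeisenberg.WHFrameIdentity g a b f) ∧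
    (∀ g : ℝ → ℂ, WeylHeisenberg.MemWiener g →
      MemLp g 2 volume ∧
      ∀ a b : ℝ, a ≠ 0 → 0 < b →
        WeylHeisenberg.CCCondition g a b ∧
        ∀ f : ℝ → ℂ, MemLp f 2 volume → WeylHeisenberg.WHFrameIdentity g a b f) := by
  refine ⟨fun g a b ha hb hg hcc f hf =>
    WeylHeisenberg.whFrameIdentity_of_ccCondition ha hb hg hcc hf, fun g hg =>
    ⟨hg.memLp_two, fun a b ha hb => ⟨hg.ccCondition ha hb, fun f hf =>
      WeylHeisenberg.whFrameIdentity_of_ccCondition ha hb hg.memLp_two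
        (hg.ccCondition ha hb) hf⟩⟩⟩
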